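/- Let $m=(m_0,m_1,\dots)$ be a bounded sequence of integers with $m_k\ge 2$ for all $k$, and let $G_m=\prod_{k=0}^\infty Z_{m_k}$, where $Z_{m_k}=\{0,1,\dots,m_k-1\}$ is the group of integers modulo $m_k$, equipped with the product $\mu$ of the uniform probability measures on the $Z_{m_k}$ (the normalized Haar measure). Put $M_0=1$, $M_{k+1}=m_kM_k$, and write each $n\in\mathbb N=\{0,1,2,\dots\}$ uniquely as $n=\sum_{k\ge 0}n_kM_k$ with $n_k\in\{0,\dots,m_k-1\}$, only finitely many $n_k$ being nonzero. For $x=(x_0,x_1,\dots)\in G_m$ let $r_k(x)=\exp(2\pi i x_k/m_k)$ and let $\psi_n(x)=\prod_{k\ge 0}r_k(x)^{n_k}$ be the Vilenkin functions. For a complex-valued $f\in L_1(G_m)$ put $$\widehat f(k)=\int_{G_m}f\,\overline{\psi_k}\,d\mu,\qquad S_n^\psi f=\sum_{k=0}^{n-1}\widehat f(k)\psi_k\quad(S_0^\psi f=0),\qquad \sigma_n^\psi f=\frac1n\sum_{k=0}^{n-1}S_k^\psi f\quad(n\ge 1).$$ Then for every $f\in L_1(G_m)$, $$\sigma_n^\psi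 f\to f\quad\text{almost everywhere as } n\to\infty.$$ -/

import Mathlib

open MeasureTheory Filter Topology

namespace Vilenkin

/-- The group `G_m`: the complete direct product of the cyclic groups `ZMod (m k)`, with the
product topology and the product `σ`-algebra of the discrete ones. -/
abbrev G (m : ℕ → ℕ) : Type := ∀ k, ZMod (m k)

noncomputable section

/-- The measure `μ_k` on `ZMod (m k)` with mass `1 / m k` at every point. -/
def coordMeasure (m : ℕ → ℕ) (k : ℕ) : Measure (ZMod (m k)) :=
  (m k : ENNReal)⁻¹ • Measure.count

/-- The direct product `μ` of the measures `μ_k`. Mathlib's `Measure.infinitePi` is the product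
measure as soon as all factors are probability measures; see
`isProbabilityMeasure_coordMeasure`. -/
def haar (m : ℕ → ℕ) : Measure (G m) :=
  Measure.infinitePi (coordMeasure m)

/-- The generalized number system: `M_0 = 1` and `M_{k+1} = m_k M_k`. -/
def M (m : ℕ → ℕ) : ℕ → ℕ
  | 0 => 1
  | k + 1 => m k * M m k

/-- The digit `n_k` in the expansion `n = ∑ n_k M_k` with `0 ≤ n_k < m_k`; see
`sum_digit_mul_M`. -/
def digit (m : ℕ → ℕ) (n k : ℕ) : ℕ := n / M m k % m k

/-- The generalized Rademacher function `r_k(x) = exp (2 π i x_k / m_k)`, where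
`x_k ∈ {0, …, m_k - 1}`. -/
def rademacher (m : ℕ → ℕ) (k : ℕ) (x : G m) : ℂ :=
  Complex.exp (2 * Real.pi * Complex.I * ((x k).val : ℂ) / (m k : ℂ))

/-- The Vilenkin function `ψ_n = ∏_k r_k ^ n_k`. The digits `n_k` with `k ≥ n` vanish
(`digit_eq_zero`), so that the product may be taken over `k < n`. -/
def psi (m : ℕ → ℕ) (n : ℕ) (x : G m) : ℂ :=
  ∏ k ∈ Finset.range n, rademacher m k x ^ digit m n k

/-- The Vilenkin–Fourier coefficient. -/
def fourierCoeff (m : ℕ → ℕ) (f : G m → ℂ) (k : ℕ) : ℂ :=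
  ∫ x, f x * (starRingEnd ℂ) (psi m k x) ∂(haar m)

/-- The partial sum `S_n f = ∑_{k < n} f̂(k) ψ_k`, with `S_0 f = 0`. -/
def partialSum (m : ℕ → ℕ) (f : G m → ℂ) (n : ℕ) (x : G m) : ℂ :=
  ∑ k ∈ Finset.range n, fourierCoeff m f k * psi m k x

/-- The Vilenkin–Fejér mean `σ_n f = (1/n) ∑_{k=0}^{n-1} S_k f` (meaningful for `n ≥ 1`). -/
def fejerMean (m : ℕ → ℕ) (f : G m → ℂ) (n : ℕ) (x : G m) : ℂ :=
  (1 / (n : ℂ)) * ∑ k ∈ Finset.range n, partialSum m f k x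

theorem isProbabilityMeasure_coordMeasure {m : ℕ → ℕ} (hm : ∀ k, 2 ≤ m k) (k : ℕ) :
    IsProbabilityMeasure (coordMeasure m k) := by
  have h0 : m k ≠ 0 := by have := hm k; omega
  have : NeZero (m k) := ⟨h0⟩
  constructor
  rw [coordMeasure, Measure.smul_apply, Measure.count_univ, ENat.card_eq_coe_fintype_card,
    ZMod.card, smul_eq_mul]
  simpa using ENNReal.inv_mul_cancel (by exact_mod_cast h0) (ENNReal.natCast_ne_top (m k))

theorem lt_M {m : ℕ → ℕ} (hm : ∀ k, 2 ≤ m k) (k : ℕ) : k < M m k := by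
  induction k with
  | zero => simp [M]
  | succ k ih =>
    have := Nat.mul_le_mul_right (M m k) (hm k)
    simp only [M]
    omega

theorem digit_eq_zero {m : ℕ → ℕ} (hm : ∀ k, 2 ≤ m k) {n k : ℕ} (h : n ≤ k) :
    digit m n k = 0 := by
  rw [digit, Nat.div_eq_of_lt (lt_of_le_of_lt h (lt_M hm k)), Nat.zero_mod]

theorem digit_lt {m : ℕ → ℕ} (hm : ∀ k, 2 ≤ m k) (n k : ℕ) : digit m n k < m k :=
  Nat.mod_lt _ (by have := hm k; omega)

theorem sum_digit_mul_M {m : ℕ → ℕ} (hm : ∀ k, 2 ≤ m k) (n : ℕ) :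
    ∑ k ∈ Finset.range n, digit m n k * M m k = n := by
  have key : ∀ K, ∑ k ∈ Finset.range K, digit m n k * M m k = n % M m K := by
    intro K
    induction K with
    | zero => simp [M, Nat.mod_one]
    | succ K ih =>
      rw [Finset.sum_range_succ, ih, M, mul_comm (m K), Nat.mod_mul, digit, mul_comm (M m K)]
  rw [key, Nat.mod_eq_of_lt (lt_M hm n)]

end

end Vilenkin

namespace Vilenkin

/-! ### Dirichlet and Fejér kernels as functions of abstract generators -/

section Kernels

variable {m : ℕ → ℕ}

/-! The mean σ_n f(x) is 1/n times the integral of f against K_n, the `fejerKernel` with generators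
z_k = r_k(x) conj r_k(y). Since ∑_{b < m_k} z_k^b is m_k if x_k = y_k and 0 otherwise, peeling
leading digits off n bounds |K_n|, up to a constant depending on sup m, by a sum of terms M_t times
a product of these factors in which at most one coordinate is left free (`norm_fejerKernel_le`). As
M_t ≤ 2^{-(s-t)} M_s, |σ_n f| is at most a constant times sup_s of `majorant`: the average of |f|
over the cell of rank s, plus the averages with coordinate t < s freed, weighted by 2^{-(s-t)}
(`enorm_fejerMean_le`).

This maximal operator has weak type (1,1) (`mul_measure_lt_majorant_le`). A stopping argument
removes the cells whose average first exceeds l; their total measure is at most ‖u‖₁/l. Seen from a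
remaining point, freeing coordinate t reaches only stopping cells of rank v with t < v ≤ s, and the
weights make the sum of all these contributions integrable, with norm at most 2‖u‖₁.

For functions of finitely many coordinates convergence holds everywhere, because S_n g = g for large
n. The weak type bound makes the class of good functions closed under L1 limits
(`fejerConverges_of_approx`), and this class grows from cylinders to measurable sets and then to all
integrable functions. -/

theorem M_pos (hm : ∀ k, 2 ≤ m k) (k : ℕ) : 0 < M m k :=
  (Nat.zero_le k).trans_lt (lt_M hm k)

theorem M_dvd_M {i j : ℕ} (h : i ≤ j) : M m i ∣ M m j := by
  induction j, h using Nat.le_induction with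
  | base => exact dvd_rfl
  | succ j _ ih => exact ih.trans (Dvd.intro_left _ rfl)

theorem two_pow_mul_M_le (hm : ∀ k, 2 ≤ m k) {i j : ℕ} (h : i ≤ j) :
    2 ^ (j - i) * M m i ≤ M m j := by
  induction j, h using Nat.le_induction with
  | base => simp
  | succ j hij ih =>
    rw [Nat.succ_sub hij, pow_succ, mul_assoc, mul_left_comm]
    exact Nat.mul_le_mul (hm j) ih

theorem exists_M_le_lt (hm : ∀ k, 2 ≤ m k) {n : ℕ} (hn : n ≠ 0) :
    ∃ A, M m A ≤ n ∧ n < M m (A + 1) := by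
  classical
  have hex : ∃ s, n < M m s := ⟨n, lt_M hm n⟩
  obtain ⟨A, hA⟩ := Nat.exists_eq_succ_of_ne_zero (n := Nat.find hex) fun h0 ↦ by
    have := Nat.find_spec hex
    rw [h0, M] at this
    omega
  refine ⟨A, not_lt.1 (Nat.find_min hex (by omega)), ?_⟩
  have := Nat.find_spec hex
  rwa [hA] at this

/-- The character with values `z k` at the generators. -/
noncomputable def character (m : ℕ → ℕ) (z : ℕ → ℂ) (n : ℕ) : ℂ :=
  ∏ k ∈ Finset.range n, z k ^ digit m n k

/-- The Dirichlet kernel of the characters `character m z`. -/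
noncomputable def dirichletKernel (m : ℕ → ℕ) (z : ℕ → ℂ) (n : ℕ) : ℂ :=
  ∑ k ∈ Finset.range n, character m z k

/-- The unnormalized Fejér kernel of the characters `character m z`. -/
noncomputable def fejerKernel (m : ℕ → ℕ) (z : ℕ → ℂ) (n : ℕ) : ℂ :=
  ∑ k ∈ Finset.range n, dirichletKernel m z k

theorem digit_eq_zero_of_lt_M (hm : ∀ k, 2 ≤ m k) {n s i : ℕ} (hn : n < M m s) (hi : s ≤ i) :
    digit m n i = 0 := by
  rw [digit, Nat.div_eq_of_lt (hn.trans_le (Nat.le_of_dvd (M_pos hm i) (M_dvd_M hi))),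
    Nat.zero_mod]

theorem character_eq_prod_of_lt_M (hm : ∀ k, 2 ≤ m k) (z : ℕ → ℂ) {n s : ℕ} (hn : n < M m s) :
    character m z n = ∏ k ∈ Finset.range s, z k ^ digit m n k := by
  rcases le_total n s with h | h
  · refine Finset.prod_subset (Finset.range_mono h) fun k _ hk ↦ ?_
    rw [digit_eq_zero hm (by simpa using hk), pow_zero]
  · refine (Finset.prod_subset (Finset.range_mono h) fun k _ hk ↦ ?_).symm
    rw [digit_eq_zero_of_lt_M hm hn (by simpa using hk), pow_zero]

theorem digit_mul_M_add_of_lt (hm : ∀ k, 2 ≤ m k) (b k : ℕ) {s i : ℕ} (hi : i < s) :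
    digit m (b * M m s + k) i = digit m k i := by
  obtain ⟨q, hq⟩ : M m (i + 1) ∣ M m s := M_dvd_M hi
  have : b * M m s + k = M m i * (m i * (q * b)) + k := by rw [hq, M]; ring
  rw [digit, digit, this, Nat.mul_add_div (M_pos hm i), Nat.mul_add_mod]

theorem digit_mul_M_add_self (hm : ∀ k, 2 ≤ m k) {b k s : ℕ} (hb : b < m s) (hk : k < M m s) :
    digit m (b * M m s + k) s = b := by
  rw [digit, mul_comm, Nat.mul_add_div (M_pos hm s), Nat.div_eq_of_lt hk, add_zero,
    Nat.mod_eq_of_lt hb]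

theorem mul_M_add_lt {b k s : ℕ} (hb : b < m s) (hk : k < M m s) :
    b * M m s + k < M m (s + 1) := by
  have := Nat.mul_le_mul_right (M m s) (Nat.succ_le_of_lt hb)
  rw [Nat.succ_mul] at this
  rw [M]
  omega

/-- No carry occurs: adding `b * M m s` to `k < M m s` only sets digit `s` to `b`. -/
theorem character_mul_M_add (hm : ∀ k, 2 ≤ m k) (z : ℕ → ℂ) {b k s : ℕ} (hb : b < m s)
    (hk : k < M m s) : character m z (b * M m s + k) = z s ^ b * character m z k := by
  rw [character_eq_prod_of_lt_M hm z (mul_M_add_lt hb hk), Finset.prod_range_succ,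
    digit_mul_M_add_self hm hb hk, mul_comm, character_eq_prod_of_lt_M hm z hk]
  congr 1
  exact Finset.prod_congr rfl fun i hi ↦ by
    rw [digit_mul_M_add_of_lt hm b k (Finset.mem_range.1 hi)]

theorem dirichletKernel_mul_M (hm : ∀ k, 2 ≤ m k) (z : ℕ → ℂ) {b s : ℕ} (hb : b ≤ m s) :
    dirichletKernel m z (b * M m s)
      = (∑ i ∈ Finset.range b, z s ^ i) * dirichletKernel m z (M m s) := by
  induction b with
  | zero => simp [dirichletKernel]
  | succ b ih =>
    rw [Nat.succ_mul, dirichletKernel, Finset.sum_range_add, ← dirichletKernel, ih (by omega),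
      Finset.sum_range_succ, add_mul, dirichletKernel, Finset.mul_sum _ _ (z s ^ b)]
    congr 1
    exact Finset.sum_congr rfl fun k hk ↦
      character_mul_M_add hm z (by omega) (Finset.mem_range.1 hk)

theorem dirichletKernel_mul_M_add (hm : ∀ k, 2 ≤ m k) (z : ℕ → ℂ) {b k s : ℕ} (hb : b < m s)
    (hk : k ≤ M m s) :
    dirichletKernel m z (b * M m s + k)
      = (∑ i ∈ Finset.range b, z s ^ i) * dirichletKernel m z (M m s)
        + z s ^ b * dirichletKernel m z k := by
  rw [dirichletKernel, Finset.sum_range_add, ← dirichletKernel, dirichletKernel_mul_M hm z hb.le]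
  congr 1
  rw [dirichletKernel, Finset.mul_sum]
  exact Finset.sum_congr rfl fun j hj ↦
    character_mul_M_add hm z hb ((Finset.mem_range.1 hj).trans_le hk)

theorem fejerKernel_mul_M_add_eq (hm : ∀ k, 2 ≤ m k) (z : ℕ → ℂ) {b k s : ℕ} (hb : b < m s)
    (hk : k ≤ M m s) :
    fejerKernel m z (b * M m s + k) = fejerKernel m z (b * M m s)
      + (k * ((∑ i ∈ Finset.range b, z s ^ i) * dirichletKernel m z (M m s))
        + z s ^ b * fejerKernel m z k) := by
  rw [fejerKernel, Finset.sum_range_add, ← fejerKernel]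
  congr 1
  rw [fejerKernel, Finset.mul_sum, ← nsmul_eq_mul, ← Finset.card_range k, ← Finset.sum_const,
    Finset.card_range, ← Finset.sum_add_distrib]
  exact Finset.sum_congr rfl fun j hj ↦
    dirichletKernel_mul_M_add hm z hb ((Finset.mem_range.1 hj).le.trans hk)

theorem fejerKernel_mul_M (hm : ∀ k, 2 ≤ m k) (z : ℕ → ℂ) {b s : ℕ} (hb : b ≤ m s) :
    fejerKernel m z (b * M m s)
      = M m s * (∑ j ∈ Finset.range b, ∑ i ∈ Finset.range j, z s ^ i)
          * dirichletKernel m z (M m s)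
        + (∑ j ∈ Finset.range b, z s ^ j) * fejerKernel m z (M m s) := by
  induction b with
  | zero => simp [fejerKernel]
  | succ b ih =>
    rw [Nat.succ_mul, fejerKernel_mul_M_add_eq hm z (by omega) le_rfl, ih (by omega),
      Finset.sum_range_succ, Finset.sum_range_succ]
    ring

variable {z : ℕ → ℂ} {c : ℕ → ℕ}

/-- For the generators used later, `c i` is `m i` or 0 according to whether the i-th coordinates
agree, so that this kernel is nonnegative and supported on a cell. -/
theorem dirichletKernel_M (hm : ∀ k, 2 ≤ m k)
    (hc : ∀ i, ∑ b ∈ Finset.range (m i), z i ^ b = c i) (s : ℕ) :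
    dirichletKernel m z (M m s) = (∏ i ∈ Finset.range s, c i : ℕ) := by
  induction s with
  | zero => simp [dirichletKernel, M, character]
  | succ s ih =>
    rw [M, dirichletKernel_mul_M hm z le_rfl, ih, hc, Finset.prod_range_succ, Nat.cast_mul,
      mul_comm]

theorem norm_sum_pow_le {w : ℂ} (hw : ‖w‖ ≤ 1) (b : ℕ) :
    ‖∑ i ∈ Finset.range b, w ^ i‖ ≤ b := by
  refine (norm_sum_le_of_le _ fun i _ ↦ ?_).trans_eq (b := ∑ i ∈ Finset.range b, (1 : ℝ)) (by simp)
  rw [norm_pow]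
  exact pow_le_one₀ (norm_nonneg _) hw

theorem norm_sum_sum_pow_le {w : ℂ} (hw : ‖w‖ ≤ 1) (b : ℕ) :
    ‖∑ j ∈ Finset.range b, ∑ i ∈ Finset.range j, w ^ i‖ ≤ (b : ℝ) ^ 2 := by
  refine (norm_sum_le_of_le _ fun j hj ↦ (norm_sum_pow_le hw j).trans
    (Nat.cast_le.2 (Finset.mem_range.1 hj).le)).trans_eq ?_
  simp [sq]

/-- The majorant of `fejerKernel m z (M m s)`. -/
def fejerMajorant (m c : ℕ → ℕ) (s : ℕ) : ℕ :=
  ∑ t ∈ Finset.range s, M m t * ∏ i ∈ (Finset.range s).erase t, c i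

theorem fejerMajorant_succ (m c : ℕ → ℕ) (s : ℕ) :
    fejerMajorant m c (s + 1)
      = c s * fejerMajorant m c s + M m s * ∏ i ∈ Finset.range s, c i := by
  rw [fejerMajorant, Finset.sum_range_succ, fejerMajorant, Finset.mul_sum]
  congr 1
  · refine Finset.sum_congr rfl fun t ht ↦ ?_
    have hts : s ≠ t := (Finset.mem_range.1 ht).ne'
    rw [Finset.range_add_one, Finset.erase_insert_of_ne hts, Finset.prod_insert (by simp)]
    ring
  · rw [Finset.range_add_one, Finset.erase_insert (by simp)]

/-- Passing from `s` to `s + 1` multiplies the old kernel by `c s` and adds a multiple of M_s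
D_{M_s}, which lacks the factor `c s`: this is the new summand t = s of the majorant. The double
geometric sum costs B². -/
theorem norm_fejerKernel_M_le (hm : ∀ k, 2 ≤ m k) {B : ℕ} (hB : ∀ k, m k ≤ B)
    (hz : ∀ i, ‖z i‖ ≤ 1) (hc : ∀ i, ∑ b ∈ Finset.range (m i), z i ^ b = c i) (s : ℕ) :
    ‖fejerKernel m z (M m s)‖ ≤ (B : ℝ) ^ 2 * fejerMajorant m c s := by
  induction s with
  | zero => simp [fejerKernel, dirichletKernel, M, fejerMajorant]
  | succ s ih =>
    rw [M, fejerKernel_mul_M hm z le_rfl, hc, dirichletKernel_M hm hc, fejerMajorant_succ]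
    refine (norm_add_le _ _).trans ?_
    simp only [norm_mul, Complex.norm_natCast]
    have h1 := (norm_sum_sum_pow_le (hz s) (m s)).trans
      (pow_le_pow_left₀ (by positivity) (Nat.cast_le.2 (hB s)) 2)
    push_cast
    have h2 := mul_le_mul_of_nonneg_left ih (Nat.cast_nonneg (α := ℝ) (c s))
    have h3 := mul_le_mul_of_nonneg_left h1
      (mul_nonneg (Nat.cast_nonneg (α := ℝ) (M m s))
        (Nat.cast_nonneg (α := ℝ) (∏ i ∈ Finset.range s, c i)))
    push_cast at h3
    nlinarith

/-- Peeling off the leading digit leaves multiples of D_{M_s} and K_{M_s}, and the kernel of the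
remainder times a factor of norm at most 1. Hence the bounds of the successive ranks add up and the
constant does not grow with `s`. -/
theorem norm_fejerKernel_le (hm : ∀ k, 2 ≤ m k) {B : ℕ} (hB : ∀ k, m k ≤ B)
    (hz : ∀ i, ‖z i‖ ≤ 1) (hc : ∀ i, ∑ b ∈ Finset.range (m i), z i ^ b = c i) (s : ℕ) {n : ℕ}
    (hn : n < M m s) :
    ‖fejerKernel m z n‖ ≤ 2 * (B : ℝ) ^ 3 * ∑ t ∈ Finset.range s,
      ((M m t * ∏ i ∈ Finset.range t, c i + fejerMajorant m c t : ℕ) : ℝ) := by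
  have hB1 : (1 : ℝ) ≤ B := by
    exact_mod_cast (one_le_two.trans (hm 0)).trans (hB 0)
  induction s generalizing n with
  | zero =>
    obtain rfl : n = 0 := by simpa [M] using hn
    simp [fejerKernel]
  | succ s ih =>
    have hpos := M_pos hm s
    set b := n / M m s
    have hb : b < m s := Nat.div_lt_of_lt_mul (by rwa [M, mul_comm] at hn)
    have hbB : (b : ℝ) ≤ B := Nat.cast_le.2 (hb.le.trans (hB s))
    have hk : n % M m s < M m s := Nat.mod_lt _ hpos
    have hkM : ((n % M m s : ℕ) : ℝ) ≤ M m s := Nat.cast_le.2 hk.le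
    have hz' := hz s
    have e : b * M m s + n % M m s = n := Nat.div_add_mod' n (M m s)
    rw [← e, fejerKernel_mul_M_add_eq hm z hb hk.le, fejerKernel_mul_M hm z hb.le,
      Finset.sum_range_succ, mul_add, dirichletKernel_M hm hc]
    set P := ∏ i ∈ Finset.range s, c i
    have h1 : ‖(M m s : ℂ) * (∑ j ∈ Finset.range b, ∑ i ∈ Finset.range j, z s ^ i) * (P : ℂ)‖
        ≤ M m s * (B : ℝ) ^ 2 * P := by
      simp only [norm_mul, Complex.norm_natCast]
      gcongr
      exact (norm_sum_sum_pow_le hz' b).trans (by gcongr)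
    have h2 : ‖(∑ j ∈ Finset.range b, z s ^ j) * fejerKernel m z (M m s)‖
        ≤ B * ((B : ℝ) ^ 2 * fejerMajorant m c s) := by
      rw [norm_mul]
      gcongr
      · exact (norm_sum_pow_le hz' b).trans hbB
      · exact norm_fejerKernel_M_le hm hB hz hc s
    have h3 : ‖((n % M m s : ℕ) : ℂ) * ((∑ i ∈ Finset.range b, z s ^ i) * (P : ℂ))‖
        ≤ M m s * (B * P) := by
      simp only [norm_mul, Complex.norm_natCast]
      gcongr
      exact (norm_sum_pow_le hz' b).trans hbB
    have h4 : ‖z s ^ b * fejerKernel m z (n % M m s)‖ ≤ ‖fejerKernel m z (n % M m s)‖ := by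
      rw [norm_mul, norm_pow]
      exact mul_le_of_le_one_left (norm_nonneg _) (pow_le_one₀ (norm_nonneg _) hz')
    have h5 := ih hk
    have h6 : (B : ℝ) ^ 2 ≤ B ^ 3 := pow_le_pow_right₀ hB1 (by norm_num)
    have h7 : (B : ℝ) ≤ B ^ 3 := le_self_pow₀ hB1 (by norm_num)
    have h8 : M m s * (B : ℝ) ^ 2 * P ≤ B ^ 3 * (M m s * P) := by
      rw [mul_right_comm, mul_comm]; gcongr
    have h9 : (M m s : ℝ) * (B * P) ≤ B ^ 3 * (M m s * P) := by
      rw [mul_left_comm]; gcongr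
    have h10 : 0 ≤ (B : ℝ) ^ 3 * fejerMajorant m c s := by positivity
    refine (norm_add_le _ _).trans ((add_le_add (norm_add_le _ _) (norm_add_le _ _)).trans ?_)
    push_cast
    push_cast at h5
    linarith

end Kernels

end Vilenkin

namespace Vilenkin

open scoped ENNReal

/-! ### Averages over cells, as conditional expectations -/

section Averages

variable {m : ℕ → ℕ} [hm : Fact (∀ k, 2 ≤ m k)]

instance : ∀ k, IsProbabilityMeasure (coordMeasure m k) :=
  isProbabilityMeasure_coordMeasure hm.out

instance : IsProbabilityMeasure (haar m) := by
  unfold haar; infer_instance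

instance (k : ℕ) : NeZero (m k) := ⟨by have := hm.out k; omega⟩

/-- The kernel of the averaging operator over the sets on which the coordinates in `S` are
fixed. -/
def cellKernel (m : ℕ → ℕ) (S : Finset ℕ) (x y : G m) : ℕ :=
  ∏ i ∈ S, if x i = y i then m i else 0

omit hm in
theorem cellKernel_comm (S : Finset ℕ) (x y : G m) : cellKernel m S x y = cellKernel m S y x := by
  simp only [cellKernel, eq_comm]

omit hm in
theorem eq_of_cellKernel_ne_zero {S : Finset ℕ} {x y : G m} (h : cellKernel m S x y ≠ 0) {i : ℕ}
    (hi : i ∈ S) : x i = y i := by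
  by_contra hne
  exact h (Finset.prod_eq_zero hi (if_neg hne))

omit hm in
theorem dependsOn_cellKernel (S : Finset ℕ) (x : G m) : DependsOn (cellKernel m S x) S :=
  fun y y' h ↦ Finset.prod_congr rfl fun i hi ↦ by rw [h i hi]

omit hm in
theorem cellKernel_mul_eq {β : Type*} [Semiring β] {S : Finset ℕ} {u : G m → β}
    (hu : DependsOn u S) (x y : G m) :
    (cellKernel m S x y : β) * u y = cellKernel m S x y * u x := by
  by_cases h : cellKernel m S x y = 0
  · simp [h]
  · rw [hu fun i hi ↦ eq_of_cellKernel_ne_zero h hi]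

theorem measurable_cellKernel (S : Finset ℕ) :
    Measurable fun p : G m × G m ↦ cellKernel m S p.1 p.2 :=
  Finset.measurable_prod _ fun i _ ↦ Measurable.ite
    (measurableSet_eq_fun (by fun_prop) (by fun_prop)) measurable_const measurable_const

theorem measurable_cellKernel_right (S : Finset ℕ) (x : G m) : Measurable (cellKernel m S x) :=
  (measurable_cellKernel S).comp measurable_prodMk_left

omit hm in
theorem coordMeasure_singleton (k : ℕ) (a : ZMod (m k)) :
    coordMeasure m k {a} = (m k : ℝ≥0∞)⁻¹ := by
  simp [coordMeasure]

theorem lintegral_cellKernel (S : Finset ℕ) (x : G m) :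
    ∫⁻ y, (cellKernel m S x y : ℝ≥0∞) ∂haar m = 1 := by
  have h : ∀ y, (cellKernel m S x y : ℝ≥0∞)
      = (Set.pi S fun i ↦ {x i}).indicator (fun _ ↦ ∏ i ∈ S, (m i : ℝ≥0∞)) y := by
    intro y
    by_cases hy : ∀ i ∈ S, y i = x i
    · rw [Set.indicator_of_mem (by simpa using hy), cellKernel, Nat.cast_prod]
      exact Finset.prod_congr rfl fun i hi ↦ by rw [if_pos (hy i hi).symm]
    · rw [Set.indicator_of_notMem (by simpa using hy)]
      by_contra h0
      exact hy fun i hi ↦ (eq_of_cellKernel_ne_zero (by simpa using h0) hi).symm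
  simp_rw [h]
  rw [lintegral_indicator_const (MeasurableSet.pi S.countable_toSet fun i _ ↦ by measurability),
    haar, Measure.infinitePi_pi _ (fun i _ ↦ measurableSet_singleton _), ← Finset.prod_mul_distrib]
  refine Finset.prod_eq_one fun i _ ↦ ?_
  rw [coordMeasure_singleton]
  exact ENNReal.mul_inv_cancel (by simpa using NeZero.ne (m i)) (by simp)

/-- The average of `u` over the set of points with the same coordinates in `S` as `x`. -/
noncomputable def cellAverage (m : ℕ → ℕ) (S : Finset ℕ) (u : G m → ℝ≥0∞) (x : G m) : ℝ≥0∞ :=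
  ∫⁻ y, cellKernel m S x y * u y ∂haar m

theorem measurable_coe_cellKernel (S : Finset ℕ) :
    Measurable fun p : G m × G m ↦ (cellKernel m S p.1 p.2 : ℝ≥0∞) :=
  measurable_from_top.comp (measurable_cellKernel S)

theorem measurable_coe_cellKernel_right (S : Finset ℕ) (x : G m) :
    Measurable fun y ↦ (cellKernel m S x y : ℝ≥0∞) :=
  measurable_from_top.comp (measurable_cellKernel_right S x)

theorem measurable_cellKernel_mul (S : Finset ℕ) {u : G m → ℝ≥0∞} (hu : Measurable u) :
    Measurable fun p : G m × G m ↦ (cellKernel m S p.1 p.2 : ℝ≥0∞) * u p.2 :=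
  (measurable_coe_cellKernel S).mul (hu.comp measurable_snd)

theorem measurable_cellAverage (S : Finset ℕ) {u : G m → ℝ≥0∞} (hu : Measurable u) :
    Measurable (cellAverage m S u) :=
  (measurable_cellKernel_mul S hu).lintegral_prod_right'

omit hm in
theorem dependsOn_cellAverage (S : Finset ℕ) (u : G m → ℝ≥0∞) :
    DependsOn (cellAverage m S u) S := by
  intro x x' h
  simp only [cellAverage]
  congr with y
  rw [cellKernel_comm, cellKernel_comm S x', dependsOn_cellKernel S y h]

omit hm in
theorem mul_cellKernel_mul_eq {S : Finset ℕ} {h : G m → ℝ≥0∞} (hS : DependsOn h S)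
    (u : G m → ℝ≥0∞) (x y : G m) :
    h x * (cellKernel m S x y * u y) = h y * u y * cellKernel m S y x := by
  have := cellKernel_mul_eq hS y x
  calc h x * (cellKernel m S x y * u y) = (cellKernel m S y x * h x) * u y := by
        rw [cellKernel_comm]; ring
    _ = _ := by rw [this]; ring

/-- The kernel vanishes unless x and y agree on `S`, where h x = h y, so `h` passes through it;
Tonelli and symmetry do the rest. Taking for `h` the constant 1, a coarser kernel or an indicator
gives preservation of the integral, the tower property and the integral over a union of cells. -/
theorem lintegral_mul_cellAverage {S : Finset ℕ} {h u : G m → ℝ≥0∞} (hS : DependsOn h S)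
    (hh : Measurable h) (hu : Measurable u) :
    ∫⁻ x, h x * cellAverage m S u x ∂haar m = ∫⁻ x, h x * u x ∂haar m := by
  have h1 : ∀ x, h x * cellAverage m S u x
      = ∫⁻ y, h x * (cellKernel m S x y * u y) ∂haar m := fun x ↦
    (lintegral_const_mul _ ((measurable_coe_cellKernel_right S x).mul hu)).symm
  have h2 : ∀ y, ∫⁻ x, h x * (cellKernel m S x y * u y) ∂haar m = h y * u y := fun y ↦ by
    rw [lintegral_congr fun x ↦ mul_cellKernel_mul_eq hS u x y,
      lintegral_const_mul _ (measurable_coe_cellKernel_right S y), lintegral_cellKernel, mul_one]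
  have h3 : Measurable fun p : G m × G m ↦ h p.1 * (cellKernel m S p.1 p.2 * u p.2) :=
    (hh.comp measurable_fst).mul (measurable_cellKernel_mul S hu)
  rw [lintegral_congr h1, lintegral_lintegral_swap h3.aemeasurable, lintegral_congr h2]

theorem lintegral_cellAverage (S : Finset ℕ) {u : G m → ℝ≥0∞} (hu : Measurable u) :
    ∫⁻ x, cellAverage m S u x ∂haar m = ∫⁻ x, u x ∂haar m := by
  simpa using lintegral_mul_cellAverage (S := S) (h := fun _ ↦ 1) (fun _ _ _ ↦ rfl)
    measurable_const hu

theorem cellAverage_cellAverage {S S' : Finset ℕ} (hS : S ⊆ S') {u : G m → ℝ≥0∞}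
    (hu : Measurable u) : cellAverage m S (cellAverage m S' u) = cellAverage m S u := by
  ext x
  exact lintegral_mul_cellAverage
    (fun y y' h ↦ congrArg _ (dependsOn_cellKernel S x fun i hi ↦ h i (hS hi)))
    (measurable_coe_cellKernel_right S x) hu

theorem setLIntegral_cellAverage {S : Finset ℕ} {A : Set (G m)} (hA : MeasurableSet A)
    (hS : DependsOn (· ∈ A) S) {u : G m → ℝ≥0∞} (hu : Measurable u) :
    ∫⁻ x in A, cellAverage m S u x ∂haar m = ∫⁻ x in A, u x ∂haar m := by
  have := lintegral_mul_cellAverage (S := S) (h := A.indicator fun _ ↦ 1)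
    (fun x y h ↦ by simp only [Set.indicator]; congr 1; exact hS h)
    (measurable_const.indicator hA) hu
  simp_rw [← Set.indicator_mul_left, one_mul] at this
  rwa [lintegral_indicator hA, lintegral_indicator hA] at this

end Averages

/-! ### Stopping cells and the weak type inequality -/

section MaximalFunction

variable {m : ℕ → ℕ} [hm : Fact (∀ k, 2 ≤ m k)]

/-- The set on which the averages over the cells of rank `s` are the first ones to exceed `l`. -/
def firstExceed (m : ℕ → ℕ) (u : G m → ℝ≥0∞) (l : ℝ≥0∞) (s : ℕ) : Set (G m) :=
  {x | l < cellAverage m (Finset.range s) u x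
    ∧ ∀ t < s, cellAverage m (Finset.range t) u x ≤ l}

theorem measurableSet_firstExceed {u : G m → ℝ≥0∞} (hu : Measurable u) (l : ℝ≥0∞) (s : ℕ) :
    MeasurableSet (firstExceed m u l s) := by
  have h : MeasurableSet {x : G m | ∀ t < s, cellAverage m (Finset.range t) u x ≤ l} := by
    simp only [Set.ofPred_forall]
    exact .iInter fun t ↦ .iInter fun _ ↦
      measurableSet_le (measurable_cellAverage _ hu) measurable_const
  exact (measurableSet_lt measurable_const (measurable_cellAverage _ hu)).inter h

omit hm in
theorem dependsOn_firstExceed (u : G m → ℝ≥0∞) (l : ℝ≥0∞) {s n : ℕ} (hs : s ≤ n) :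
    DependsOn (· ∈ firstExceed m u l s) (Finset.range n) := by
  intro x y h
  have key : ∀ t ≤ s, cellAverage m (Finset.range t) u x = cellAverage m (Finset.range t) u y :=
    fun t ht ↦ dependsOn_cellAverage _ u fun i hi ↦ h i (by simp at hi ⊢; omega)
  simp only [firstExceed, Set.mem_ofPred_eq, eq_iff_iff]
  rw [key s le_rfl]
  exact and_congr_right fun _ ↦ forall₂_congr fun t ht ↦ by rw [key t ht.le]

omit hm in
theorem pairwise_disjoint_firstExceed (u : G m → ℝ≥0∞) (l : ℝ≥0∞) :
    Pairwise (Function.onFun Disjoint (firstExceed m u l)) := by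
  intro s t hst
  refine Set.disjoint_left.2 fun x hs ht ↦ ?_
  rcases hst.lt_or_gt with h | h
  · exact (ht.2 s h).not_gt hs.1
  · exact (hs.2 t h).not_gt ht.1

omit hm in
theorem exists_mem_firstExceed {u : G m → ℝ≥0∞} {l : ℝ≥0∞} {s : ℕ} {x : G m}
    (h : l < cellAverage m (Finset.range s) u x) : ∃ v ≤ s, x ∈ firstExceed m u l v := by
  classical
  have hex : ∃ v, l < cellAverage m (Finset.range v) u x := ⟨s, h⟩
  exact ⟨Nat.find hex, Nat.find_min' hex h, Nat.find_spec hex,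
    fun t ht ↦ not_lt.1 (Nat.find_min hex ht)⟩

theorem tsum_setLIntegral_firstExceed_le {u : G m → ℝ≥0∞} (hu : Measurable u) (l : ℝ≥0∞) :
    ∑' s, ∫⁻ x in firstExceed m u l s, u x ∂haar m ≤ ∫⁻ x, u x ∂haar m := by
  rw [← lintegral_iUnion (measurableSet_firstExceed hu l) (pairwise_disjoint_firstExceed u l)]
  exact setLIntegral_le_lintegral _ _

/-- Each stopping set is a union of cells of its rank, so `u` and its average have the same integral
there, and the average exceeds `l`. -/
theorem mul_measure_iUnion_firstExceed_le {u : G m → ℝ≥0∞} (hu : Measurable u) (l : ℝ≥0∞) :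
    l * haar m (⋃ s, firstExceed m u l s) ≤ ∫⁻ x, u x ∂haar m := by
  rw [measure_iUnion (pairwise_disjoint_firstExceed u l) (measurableSet_firstExceed hu l),
    ← ENNReal.tsum_mul_left]
  refine (ENNReal.tsum_le_tsum fun s ↦ ?_).trans (tsum_setLIntegral_firstExceed_le hu l)
  rw [← setLIntegral_cellAverage (measurableSet_firstExceed hu l s)
    (dependsOn_firstExceed u l le_rfl) hu, ← setLIntegral_const]
  exact setLIntegral_mono (measurable_cellAverage _ hu) fun x hx ↦ hx.1.le

/-- The part of the average over the cells of rank `s` on the cells of rank between `t + 1` and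
`s` on which the averages exceed `l` for the first time. -/
noncomputable def excess (m : ℕ → ℕ) (u : G m → ℝ≥0∞) (l : ℝ≥0∞) (s t : ℕ) (x : G m) : ℝ≥0∞ :=
  ∑ v ∈ Finset.Ioc t s, (firstExceed m u l v).indicator (cellAverage m (Finset.range s) u) x

theorem measurable_excess {u : G m → ℝ≥0∞} (hu : Measurable u) (l : ℝ≥0∞) (s t : ℕ) :
    Measurable (excess m u l s t) :=
  Finset.measurable_fun_sum _ fun v _ ↦
    (measurable_cellAverage _ hu).indicator (measurableSet_firstExceed hu l v)

theorem lintegral_excess {u : G m → ℝ≥0∞} (hu : Measurable u) (l : ℝ≥0∞) (s t : ℕ) :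
    ∫⁻ x, excess m u l s t x ∂haar m
      = ∑ v ∈ Finset.Ioc t s, ∫⁻ x in firstExceed m u l v, u x ∂haar m := by
  simp only [excess]
  rw [lintegral_finsetSum _ fun v _ ↦
    (measurable_cellAverage _ hu).indicator (measurableSet_firstExceed hu l v)]
  refine Finset.sum_congr rfl fun v hv ↦ ?_
  rw [lintegral_indicator (measurableSet_firstExceed hu l v),
    setLIntegral_cellAverage (measurableSet_firstExceed hu l v)
      (dependsOn_firstExceed u l (Finset.mem_Ioc.1 hv).2) hu]

/-- By the tower property `u` may be replaced by its average of rank `s`, which is at most `l`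
except on stopping cells of rank at most `s`. Those of rank at most `t` are out of reach from `x`.
-/
theorem cellAverage_erase_le {u : G m → ℝ≥0∞} (hu : Measurable u) {l : ℝ≥0∞} {s t : ℕ}
    {x : G m} (hx : x ∉ ⋃ v, firstExceed m u l v) :
    cellAverage m ((Finset.range s).erase t) u x
      ≤ l + cellAverage m ((Finset.range s).erase t) (excess m u l s t) x := by
  have hk := measurable_coe_cellKernel_right ((Finset.range s).erase t) x
  rw [← cellAverage_cellAverage (Finset.erase_subset t (Finset.range s)) hu]
  calc _ ≤ ∫⁻ y, (cellKernel m ((Finset.range s).erase t) x y : ℝ≥0∞)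
            * (l + excess m u l s t y) ∂haar m := by
        refine lintegral_mono fun y ↦ ?_
        by_cases h0 : cellKernel m ((Finset.range s).erase t) x y = 0
        · simp [h0]
        refine mul_le_mul_right ?_ _
        by_cases hy : l < cellAverage m (Finset.range s) u y
        · obtain ⟨v, hvs, hv⟩ := exists_mem_firstExceed hy
          -- Below `s` only coordinate `t` is free, so for v ≤ t the points x and y share all
          -- coordinates below `v`, and x would lie in the same stopping set.
          have htv : t < v := by
            by_contra! hvt
            refine hx (Set.mem_iUnion.2 ⟨v, ?_⟩)
            have : (x ∈ firstExceed m u l v) = (y ∈ firstExceed m u l v) :=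
              dependsOn_firstExceed u l le_rfl fun i hi ↦
                eq_of_cellKernel_ne_zero h0 (by simp at hi ⊢; omega)
            rwa [this]
          refine le_add_left ?_
          rw [excess]
          refine le_trans ?_ (Finset.single_le_sum (fun _ _ ↦ zero_le)
            (Finset.mem_Ioc.2 ⟨htv, hvs⟩))
          rw [Set.indicator_of_mem hv]
        · exact le_add_right (not_lt.1 hy)
    _ = _ := by
        simp_rw [mul_add]
        rw [lintegral_add_left (hk.mul_const l), lintegral_mul_const _ hk,
          lintegral_cellKernel, one_mul, cellAverage]

/-- The operator that dominates the Fejér means of order `M m s`. -/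
noncomputable def majorant (m : ℕ → ℕ) (u : G m → ℝ≥0∞) (s : ℕ) (x : G m) : ℝ≥0∞ :=
  cellAverage m (Finset.range s) u x
    + ∑ t ∈ Finset.range s, 2⁻¹ ^ (s - t) * cellAverage m ((Finset.range s).erase t) u x

theorem sum_two_inv_pow_sub_le (s : ℕ) :
    ∑ t ∈ Finset.range s, (2⁻¹ : ℝ≥0∞) ^ (s - t) ≤ 1 := by
  induction s with
  | zero => simp
  | succ s ih =>
    have : ∑ t ∈ Finset.range s, (2⁻¹ : ℝ≥0∞) ^ (s + 1 - t)
        = 2⁻¹ * ∑ t ∈ Finset.range s, (2⁻¹ : ℝ≥0∞) ^ (s - t) := by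
      rw [Finset.mul_sum]
      exact Finset.sum_congr rfl fun t ht ↦ by
        rw [Nat.succ_sub (Finset.mem_range.1 ht).le, pow_succ']
    rw [Finset.sum_range_succ, this, Nat.add_sub_cancel_left, pow_one]
    calc _ ≤ 2⁻¹ * 1 + (2⁻¹ : ℝ≥0∞) := by gcongr
      _ = 1 := by rw [mul_one, ENNReal.inv_two_add_inv_two]

theorem tsum_two_inv_pow_sub_le (v : ℕ) :
    ∑' s, (if v ≤ s then (2⁻¹ : ℝ≥0∞) ^ (s - v) else 0) ≤ 2 := by
  have h : ∀ s, s ∉ Set.range (v + ·) → (if v ≤ s then (2⁻¹ : ℝ≥0∞) ^ (s - v) else 0) = 0 := by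
    intro s hs
    refine if_neg fun hvs ↦ hs ⟨s - v, by simp; omega⟩
  rw [← (add_right_injective v).tsum_eq (fun s hs ↦ by_contra fun h' ↦ hs (h s h'))]
  simp [ENNReal.tsum_geometric]

/-- The sum of the contributions of all `excess m u l s t` to `majorant m u s`. -/
noncomputable def totalExcess (m : ℕ → ℕ) (u : G m → ℝ≥0∞) (l : ℝ≥0∞) (x : G m) : ℝ≥0∞ :=
  ∑' s, ∑ t ∈ Finset.range s,
    2⁻¹ ^ (s - t) * cellAverage m ((Finset.range s).erase t) (excess m u l s t) x

theorem measurable_totalExcess {u : G m → ℝ≥0∞} (hu : Measurable u) (l : ℝ≥0∞) :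
    Measurable (totalExcess m u l) :=
  Measurable.tsum fun s ↦ Finset.measurable_fun_sum _ fun t _ ↦
    (measurable_cellAverage _ (measurable_excess hu l s t)).const_mul _

/-- For t < v ≤ s the weight factors as 2^{-(s-v)} 2^{-(v-t)}. After exchanging sums, the integral
of `u` over the stopping set of rank `v` meets two geometric series: over t < v, at most 1, and over
s ≥ v, at most 2. -/
theorem lintegral_totalExcess_le {u : G m → ℝ≥0∞} (hu : Measurable u) (l : ℝ≥0∞) :
    ∫⁻ x, totalExcess m u l x ∂haar m ≤ 2 * ∫⁻ x, u x ∂haar m := by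
  have hmeas : ∀ s t, Measurable
      (cellAverage m ((Finset.range s).erase t) (excess m u l s t)) :=
    fun s t ↦ measurable_cellAverage _ (measurable_excess hu l s t)
  simp only [totalExcess]
  rw [lintegral_tsum fun s ↦ (Finset.measurable_fun_sum _ fun t _ ↦
    (hmeas s t).const_mul _).aemeasurable]
  set I : ℕ → ℝ≥0∞ := fun v ↦ ∫⁻ x in firstExceed m u l v, u x ∂haar m
  calc _ = ∑' s, ∑ t ∈ Finset.range s, 2⁻¹ ^ (s - t) * ∑ v ∈ Finset.Ioc t s, I v := by
        refine tsum_congr fun s ↦ ?_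
        rw [lintegral_finsetSum _ fun t _ ↦ (hmeas s t).const_mul _]
        refine Finset.sum_congr rfl fun t _ ↦ ?_
        rw [lintegral_const_mul _ (hmeas s t),
          lintegral_cellAverage _ (measurable_excess hu l s t), lintegral_excess hu]
    _ = ∑' s, ∑ v ∈ Finset.range (s + 1),
          I v * (2⁻¹ ^ (s - v) * ∑ t ∈ Finset.range v, 2⁻¹ ^ (v - t)) := by
        refine tsum_congr fun s ↦ ?_
        simp_rw [Finset.mul_sum]
        rw [Finset.sum_comm' (t' := Finset.range (s + 1)) (s' := fun v ↦ Finset.range v)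
          (by intro t v; simp; omega)]
        refine Finset.sum_congr rfl fun v hv ↦ Finset.sum_congr rfl fun t ht ↦ ?_
        rw [← pow_add, mul_comm]
        congr 2
        simp at hv ht
        omega
    _ ≤ ∑' s, ∑' v, I v * (if v ≤ s then 2⁻¹ ^ (s - v) else 0) := by
        refine ENNReal.tsum_le_tsum fun s ↦ le_trans (Finset.sum_le_sum fun v hv ↦ ?_)
          (ENNReal.sum_le_tsum (Finset.range (s + 1)))
        rw [if_pos (by simpa [Nat.lt_succ_iff] using hv)]
        exact mul_le_mul_right (mul_le_of_le_one_right' (sum_two_inv_pow_sub_le v)) _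
    _ = ∑' v, I v * ∑' s, (if v ≤ s then 2⁻¹ ^ (s - v) else 0) := by
        rw [ENNReal.tsum_comm]
        simp_rw [ENNReal.tsum_mul_left]
    _ ≤ ∑' v, I v * 2 := ENNReal.tsum_le_tsum fun v ↦
        mul_le_mul_right (tsum_two_inv_pow_sub_le v) _
    _ ≤ 2 * ∫⁻ x, u x ∂haar m := by
        rw [ENNReal.tsum_mul_right, mul_comm]
        exact mul_le_mul_right (tsum_setLIntegral_firstExceed_le hu l) _

theorem majorant_le {u : G m → ℝ≥0∞} (hu : Measurable u) {l : ℝ≥0∞} {x : G m}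
    (hx : x ∉ ⋃ v, firstExceed m u l v) (s : ℕ) :
    majorant m u s x ≤ 2 * l + totalExcess m u l x := by
  rw [majorant, two_mul, add_assoc]
  refine add_le_add ?_ ?_
  · by_contra! h
    obtain ⟨v, -, hv⟩ := exists_mem_firstExceed h
    exact hx (Set.mem_iUnion.2 ⟨v, hv⟩)
  calc _ ≤ ∑ t ∈ Finset.range s, (2⁻¹ ^ (s - t) * l + 2⁻¹ ^ (s - t)
            * cellAverage m ((Finset.range s).erase t) (excess m u l s t) x) := by
        refine Finset.sum_le_sum fun t _ ↦ ?_
        rw [← mul_add]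
        exact mul_le_mul_right (cellAverage_erase_le hu hx) _
    _ ≤ _ := by
        rw [Finset.sum_add_distrib, ← Finset.sum_mul]
        exact add_le_add (mul_le_of_le_one_left' (sum_two_inv_pow_sub_le s))
          (ENNReal.le_tsum s)

/-- The weak type inequality for the maximal operator of `majorant`. -/
theorem mul_measure_lt_majorant_le {u : G m → ℝ≥0∞} (hu : Measurable u) (l : ℝ≥0∞) :
    l * haar m {x | ∃ s, 3 * l < majorant m u s x} ≤ 3 * ∫⁻ x, u x ∂haar m := by
  have hsub : {x | ∃ s, 3 * l < majorant m u s x}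
      ⊆ (⋃ v, firstExceed m u l v) ∪ {x | l ≤ totalExcess m u l x} := by
    rintro x ⟨s, hs⟩
    by_contra hx
    rw [Set.mem_union, not_or, Set.mem_ofPred_eq, not_le] at hx
    refine hs.not_ge ((majorant_le hu hx.1 s).trans ?_)
    calc _ ≤ 2 * l + l := by gcongr; exact hx.2.le
      _ = 3 * l := by ring
  calc _ ≤ l * haar m (⋃ v, firstExceed m u l v) + l * haar m {x | l ≤ totalExcess m u l x} := by
        rw [← mul_add]
        exact mul_le_mul_right ((measure_mono hsub).trans (measure_union_le _ _)) _
    _ ≤ (∫⁻ x, u x ∂haar m) + 2 * ∫⁻ x, u x ∂haar m :=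
        add_le_add (mul_measure_iUnion_firstExceed_le hu l)
          ((mul_meas_ge_le_lintegral (measurable_totalExcess hu l) l).trans
            (lintegral_totalExcess_le hu l))
    _ = _ := by ring

end MaximalFunction

end Vilenkin

namespace Vilenkin

open scoped ENNReal ComplexConjugate

/-! ### Vilenkin functions and integral formulas for the means -/

section Characters

variable {m : ℕ → ℕ}

theorem rademacher_eq_pow (k : ℕ) (x : G m) :
    rademacher m k x = Complex.exp (2 * Real.pi * Complex.I / m k) ^ (x k).val := by
  rw [rademacher, ← Complex.exp_nat_mul]
  congr 1
  ring

theorem norm_rademacher (k : ℕ) (x : G m) : ‖rademacher m k x‖ = 1 := by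
  have : 2 * Real.pi * Complex.I * ((x k).val : ℂ) / (m k : ℂ)
      = ((2 * Real.pi * (x k).val / m k : ℝ) : ℂ) * Complex.I := by push_cast; ring
  rw [rademacher, this, Complex.norm_exp_ofReal_mul_I]

theorem norm_psi (n : ℕ) (x : G m) : ‖psi m n x‖ = 1 := by
  simp [psi, norm_prod, norm_rademacher]

theorem measurable_psi (n : ℕ) : Measurable (psi m n) := by
  refine Finset.measurable_prod _ fun k _ ↦ Measurable.pow_const ?_ _
  exact (measurable_from_top (f := fun a : ZMod (m k) ↦
    Complex.exp (2 * Real.pi * Complex.I * (a.val : ℂ) / (m k : ℂ)))).comp (measurable_pi_apply k)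

/-- The generators of the characters `n ↦ ψ_n(x) * conj ψ_n(y)`. -/
noncomputable def rademacherPair (m : ℕ → ℕ) (x y : G m) (k : ℕ) : ℂ :=
  rademacher m k x * conj (rademacher m k y)

theorem norm_rademacherPair (x y : G m) (k : ℕ) : ‖rademacherPair m x y k‖ = 1 := by
  simp [rademacherPair, norm_rademacher]

theorem character_rademacherPair (x y : G m) (n : ℕ) :
    character m (rademacherPair m x y) n = psi m n x * conj (psi m n y) := by
  simp only [character, rademacherPair, psi, map_prod, map_pow, mul_pow, Finset.prod_mul_distrib]

variable [hm : Fact (∀ k, 2 ≤ m k)]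

theorem rademacherPair_eq_one_iff (x y : G m) (k : ℕ) :
    rademacherPair m x y k = 1 ↔ x k = y k := by
  have hinv : conj (rademacher m k y) = (rademacher m k y)⁻¹ :=
    (Complex.inv_eq_conj (norm_rademacher k y)).symm
  have hne : rademacher m k y ≠ 0 := norm_ne_zero_iff.1 (by simp [norm_rademacher])
  rw [rademacherPair, hinv, mul_inv_eq_one₀ hne, rademacher_eq_pow, rademacher_eq_pow]
  refine ⟨fun h ↦ ZMod.val_injective _ ?_, fun h ↦ by rw [h]⟩
  exact (Complex.isPrimitiveRoot_exp _ (NeZero.ne (m k))).pow_inj (ZMod.val_lt _) (ZMod.val_lt _) h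

theorem rademacherPair_pow (x y : G m) (k : ℕ) : rademacherPair m x y k ^ m k = 1 := by
  have h := (Complex.isPrimitiveRoot_exp _ (NeZero.ne (m k))).pow_eq_one
  simp only [rademacherPair, rademacher_eq_pow, mul_pow, map_pow]
  rw [← pow_mul, ← pow_mul, mul_comm _ (m k), mul_comm _ (m k), pow_mul, pow_mul, ← map_pow, h]
  simp

theorem sum_rademacherPair_pow (x y : G m) (k : ℕ) :
    ∑ b ∈ Finset.range (m k), rademacherPair m x y k ^ b
      = ((if x k = y k then m k else 0 : ℕ) : ℂ) := by
  split_ifs with h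
  · simp [(rademacherPair_eq_one_iff x y k).2 h]
  · rw [geom_sum_eq (mt (rademacherPair_eq_one_iff x y k).1 h), rademacherPair_pow]
    simp

omit hm in
theorem integrable_mul_conj_psi {f : G m → ℂ} (hf : Integrable f (haar m)) (n : ℕ) :
    Integrable (fun y ↦ f y * conj (psi m n y)) (haar m) :=
  hf.mul_bdd (c := 1)
    (Complex.continuous_conj.measurable.comp (measurable_psi n)).aestronglyMeasurable
    (.of_forall fun y ↦ by simp [norm_psi])

omit hm in
theorem mul_character_eq (f : G m → ℂ) (x y : G m) (n : ℕ) :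
    f y * character m (rademacherPair m x y) n = psi m n x * (f y * conj (psi m n y)) := by
  rw [character_rademacherPair, mul_left_comm]

omit hm in
theorem integrable_mul_character {f : G m → ℂ} (hf : Integrable f (haar m)) (x : G m) (n : ℕ) :
    Integrable (fun y ↦ f y * character m (rademacherPair m x y) n) (haar m) := by
  simp_rw [mul_character_eq]
  exact (integrable_mul_conj_psi hf n).const_mul _

omit hm in
theorem integrable_mul_dirichletKernel {f : G m → ℂ} (hf : Integrable f (haar m)) (x : G m)
    (n : ℕ) : Integrable (fun y ↦ f y * dirichletKernel m (rademacherPair m x y) n) (haar m) := by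
  simp_rw [dirichletKernel, Finset.mul_sum]
  exact integrable_finsetSum _ fun k _ ↦ integrable_mul_character hf x k

omit hm in
theorem partialSum_eq_integral {f : G m → ℂ} (hf : Integrable f (haar m)) (x : G m) (n : ℕ) :
    partialSum m f n x = ∫ y, f y * dirichletKernel m (rademacherPair m x y) n ∂haar m := by
  simp_rw [dirichletKernel, Finset.mul_sum]
  rw [integral_finsetSum _ fun k _ ↦ integrable_mul_character hf x k, partialSum]
  refine Finset.sum_congr rfl fun k _ ↦ ?_
  simp_rw [mul_character_eq]
  rw [integral_const_mul, fourierCoeff, mul_comm]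

omit hm in
theorem fejerMean_eq_integral {f : G m → ℂ} (hf : Integrable f (haar m)) (x : G m) (n : ℕ) :
    fejerMean m f n x
      = (1 / (n : ℂ)) * ∫ y, f y * fejerKernel m (rademacherPair m x y) n ∂haar m := by
  simp_rw [fejerKernel, Finset.mul_sum]
  rw [integral_finsetSum _ fun k _ ↦ integrable_mul_dirichletKernel hf x k, fejerMean]
  simp_rw [partialSum_eq_integral hf]

omit hm in
theorem fourierCoeff_add {f g : G m → ℂ} (hf : Integrable f (haar m)) (hg : Integrable g (haar m))
    (k : ℕ) : fourierCoeff m (f + g) k = fourierCoeff m f k + fourierCoeff m g k := by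
  simp only [fourierCoeff, Pi.add_apply, add_mul]
  exact integral_add (integrable_mul_conj_psi hf k) (integrable_mul_conj_psi hg k)

omit hm in
theorem fejerMean_add {f g : G m → ℂ} (hf : Integrable f (haar m)) (hg : Integrable g (haar m))
    (n : ℕ) (x : G m) : fejerMean m (f + g) n x = fejerMean m f n x + fejerMean m g n x := by
  simp only [fejerMean, partialSum, fourierCoeff_add hf hg, add_mul, Finset.sum_add_distrib,
    mul_add]

omit hm in
theorem fejerMean_neg (f : G m → ℂ) (n : ℕ) (x : G m) :
    fejerMean m (-f) n x = -fejerMean m f n x := by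
  simp only [fejerMean, partialSum, fourierCoeff, Pi.neg_apply, neg_mul, integral_neg,
    Finset.sum_neg_distrib, mul_neg]

omit hm in
-- Equality holds at every point, since only the coefficients of `f` enter; this permits passing to
-- a measurable representative.
theorem fejerMean_congr_ae {f g : G m → ℂ} (h : f =ᵐ[haar m] g) (n : ℕ) (x : G m) :
    fejerMean m f n x = fejerMean m g n x := by
  have : fourierCoeff m f = fourierCoeff m g := funext fun k ↦
    integral_congr_ae (h.mono fun y hy ↦ by simp only [hy])
  simp only [fejerMean, partialSum, this]

end Characters

/-! ### Domination of the Fejér means by the maximal operator -/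

section Domination

variable {m : ℕ → ℕ} [hm : Fact (∀ k, 2 ≤ m k)]

theorem M_le_two_inv_pow_mul {i j : ℕ} (h : i ≤ j) :
    (M m i : ℝ≥0∞) ≤ 2⁻¹ ^ (j - i) * M m j := by
  have h1 : (2 : ℝ≥0∞) ^ (j - i) * M m i ≤ M m j := by
    exact_mod_cast two_pow_mul_M_le hm.out h
  rw [← ENNReal.inv_pow, mul_comm, ← div_eq_mul_inv, ENNReal.le_div_iff_mul_le (by simp) (by simp),
    mul_comm]
  exact h1

/-- The kernel of `majorant`. -/
noncomputable def majorantKernel (m : ℕ → ℕ) (s : ℕ) (x y : G m) : ℝ≥0∞ :=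
  cellKernel m (Finset.range s) x y
    + ∑ t ∈ Finset.range s, 2⁻¹ ^ (s - t) * (cellKernel m ((Finset.range s).erase t) x y : ℝ≥0∞)

theorem measurable_majorantKernel (s : ℕ) (x : G m) : Measurable (majorantKernel m s x) :=
  (measurable_coe_cellKernel_right _ x).add <| Finset.measurable_fun_sum _ fun _ _ ↦
    (measurable_coe_cellKernel_right _ x).const_mul _

theorem lintegral_majorantKernel_mul (s : ℕ) (x : G m) {u : G m → ℝ≥0∞} (hu : Measurable u) :
    ∫⁻ y, majorantKernel m s x y * u y ∂haar m = majorant m u s x := by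
  simp only [majorantKernel, majorant, add_mul, Finset.sum_mul, mul_assoc]
  have h : ∀ S : Finset ℕ, Measurable fun y ↦ (cellKernel m S x y : ℝ≥0∞) * u y :=
    fun S ↦ (measurable_coe_cellKernel_right S x).mul hu
  rw [lintegral_add_left (h _), lintegral_finsetSum _ fun t _ ↦ (h _).const_mul _]
  congr 1
  exact Finset.sum_congr rfl fun t _ ↦ lintegral_const_mul _ (h _)

/-- The growth M_t ≤ 2^{-(s-t)} M_s turns the coefficients M_t into the decaying weights of
`majorantKernel`. -/
theorem cellKernel_add_fejerMajorant_le (s : ℕ) (x y : G m) :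
    ((M m s * cellKernel m (Finset.range s) x y
      + fejerMajorant m (fun i ↦ if x i = y i then m i else 0) s : ℕ) : ℝ≥0∞)
      ≤ M m s * majorantKernel m s x y := by
  rw [majorantKernel, mul_add, fejerMajorant, Nat.cast_add, Nat.cast_mul, Nat.cast_sum,
    Finset.mul_sum]
  refine add_le_add le_rfl (Finset.sum_le_sum fun t ht ↦ ?_)
  rw [Nat.cast_mul, ← mul_assoc, mul_comm (M m s : ℝ≥0∞)]
  exact mul_le_mul_left (M_le_two_inv_pow_mul (Finset.mem_range.1 ht).le) _

theorem enorm_fejerKernel_le {B : ℕ} (hB : ∀ k, m k ≤ B) (x y : G m) {n A : ℕ}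
    (hn : n < M m (A + 1)) :
    ‖fejerKernel m (rademacherPair m x y) n‖ₑ
      ≤ 2 * B ^ 3 * M m A * ∑ t ∈ Finset.range (A + 1), 2⁻¹ ^ (A - t) * majorantKernel m t x y := by
  have h := norm_fejerKernel_le hm.out hB (fun i ↦ (norm_rademacherPair x y i).le)
    (sum_rademacherPair_pow x y) (A + 1) hn
  calc _ ≤ ((2 * B ^ 3 * ∑ t ∈ Finset.range (A + 1), (M m t * cellKernel m (Finset.range t) x y
          + fejerMajorant m (fun i ↦ if x i = y i then m i else 0) t) : ℕ) : ℝ≥0∞) := by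
        rw [← ofReal_norm, ← ENNReal.ofReal_natCast]
        refine ENNReal.ofReal_le_ofReal (h.trans_eq ?_)
        push_cast [cellKernel]
        rfl
    _ ≤ 2 * B ^ 3 * ∑ t ∈ Finset.range (A + 1),
          2⁻¹ ^ (A - t) * M m A * majorantKernel m t x y := by
        rw [Nat.cast_mul, Nat.cast_sum]
        refine mul_le_mul' (by push_cast; rfl) (Finset.sum_le_sum fun t ht ↦ ?_)
        exact (cellKernel_add_fejerMajorant_le t x y).trans (mul_le_mul_left
          (M_le_two_inv_pow_mul (Nat.lt_succ_iff.1 (Finset.mem_range.1 ht))) _)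
    _ = _ := by
        rw [mul_assoc (2 * (B : ℝ≥0∞) ^ 3), Finset.mul_sum _ _ (M m A : ℝ≥0∞)]
        congr 1
        exact Finset.sum_congr rfl fun t _ ↦ by ring

theorem enorm_fejerMean_le {B : ℕ} (hB : ∀ k, m k ≤ B) {f : G m → ℂ}
    (hf : Integrable f (haar m)) (hfm : Measurable f) {x : G m} {l : ℝ≥0∞}
    (hl : ∀ s, majorant m (fun y ↦ ‖f y‖ₑ) s x ≤ l) (n : ℕ) :
    ‖fejerMean m f n x‖ₑ ≤ 4 * B ^ 3 * l := by
  rcases eq_or_ne n 0 with rfl | hn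
  · simp [fejerMean]
  obtain ⟨A, hA, hnA⟩ := exists_M_le_lt hm.out hn
  have hk : ∀ t, Measurable fun y ↦ majorantKernel m t x y * ‖f y‖ₑ :=
    fun t ↦ (measurable_majorantKernel t x).mul hfm.enorm
  have hn0 : (n : ℝ≥0∞) ≠ 0 := by simpa using hn
  have key : ∫⁻ y, ‖f y * fejerKernel m (rademacherPair m x y) n‖ₑ ∂haar m
      ≤ 4 * B ^ 3 * l * n := by
    calc _ ≤ ∫⁻ y, 2 * B ^ 3 * M m A * ∑ t ∈ Finset.range (A + 1),
            2⁻¹ ^ (A - t) * (majorantKernel m t x y * ‖f y‖ₑ) ∂haar m := by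
          refine lintegral_mono fun y ↦ ?_
          simp only [← mul_assoc]
          rw [← Finset.sum_mul, ← mul_assoc, enorm_mul, mul_comm]
          exact mul_le_mul_left (enorm_fejerKernel_le hB x y hnA) _
      _ = 2 * B ^ 3 * M m A * ∑ t ∈ Finset.range (A + 1),
            2⁻¹ ^ (A - t) * majorant m (fun y ↦ ‖f y‖ₑ) t x := by
          rw [lintegral_const_mul _ (Finset.measurable_fun_sum _ fun t _ ↦ (hk t).const_mul _),
            lintegral_finsetSum _ fun t _ ↦ (hk t).const_mul _]
          congr 1
          refine Finset.sum_congr rfl fun t _ ↦ ?_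
          rw [lintegral_const_mul _ (hk t), lintegral_majorantKernel_mul t x hfm.enorm]
      -- The weights 2^{-(A-t)} over t ≤ A sum to at most 1 + 1. Then M_A ≤ n lets the prefactor 1/n
      -- cancel.
      _ ≤ 2 * B ^ 3 * M m A * (2 * l) := by
          refine mul_le_mul_right ((Finset.sum_le_sum fun t _ ↦
            mul_le_mul_right (hl t) _).trans ?_) _
          rw [← Finset.sum_mul]
          refine mul_le_mul_left ?_ _
          rw [Finset.sum_range_succ, Nat.sub_self, pow_zero]
          exact (add_le_add (sum_two_inv_pow_sub_le A) le_rfl).trans_eq one_add_one_eq_two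
      _ ≤ 2 * B ^ 3 * n * (2 * l) := by gcongr
      _ = _ := by ring
  rw [fejerMean_eq_integral hf, enorm_mul]
  calc _ ≤ (n : ℝ≥0∞)⁻¹ * (4 * B ^ 3 * l * n) := by
        refine mul_le_mul' ?_ ((enorm_integral_le_lintegral_enorm _).trans key)
        rw [one_div, enorm_inv (by exact_mod_cast hn), ← ofReal_norm, Complex.norm_natCast,
          ENNReal.ofReal_natCast]
    _ = _ := by
        rw [mul_left_comm, ENNReal.inv_mul_cancel hn0 (by simp), mul_one]

end Domination

/-! ### Functions of finitely many coordinates -/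

section FinitelyManyCoordinates

variable {m : ℕ → ℕ} [hm : Fact (∀ k, 2 ≤ m k)]

theorem integral_cellKernel (S : Finset ℕ) (x : G m) :
    ∫ y, (cellKernel m S x y : ℂ) ∂haar m = 1 := by
  have h1 : ∫ y, (cellKernel m S x y : ℝ) ∂haar m = 1 := by
    rw [integral_eq_lintegral_of_nonneg_ae (.of_forall fun y ↦ Nat.cast_nonneg _)
      (measurable_from_top.comp (measurable_cellKernel_right S x)).aestronglyMeasurable]
    simp [lintegral_cellKernel]
  have := congrArg ((↑) : ℝ → ℂ) h1
  rw [← integral_complex_ofReal] at this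
  simpa using this

/-- The Dirichlet kernel of order M_s averages over the cell of rank `s`, on which `g` is constant.
-/
theorem partialSum_M_eq_self {g : G m → ℂ} (hg : Integrable g (haar m)) {s : ℕ}
    (hs : DependsOn g (Finset.range s)) (x : G m) : partialSum m g (M m s) x = g x := by
  rw [partialSum_eq_integral hg]
  have : ∀ y, g y * dirichletKernel m (rademacherPair m x y) (M m s)
      = cellKernel m (Finset.range s) x y * g x := by
    intro y
    rw [dirichletKernel_M hm.out (sum_rademacherPair_pow x y), ← cellKernel_mul_eq hs, mul_comm]
    rfl
  simp_rw [this]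
  rw [integral_mul_const, integral_cellKernel, one_mul]

/-- Parseval without orthogonality: expand the factor conj g as its own partial sum and integrate
termwise. -/
theorem sum_norm_fourierCoeff_sq {g : G m → ℂ} (hg : Integrable g (haar m)) {s : ℕ}
    (hs : DependsOn g (Finset.range s)) :
    ((∑ k ∈ Finset.range (M m s), ‖fourierCoeff m g k‖ ^ 2 : ℝ) : ℂ)
      = ∫ x, g x * conj (g x) ∂haar m := by
  have : ∀ x, g x * conj (g x) = ∑ k ∈ Finset.range (M m s),
      conj (fourierCoeff m g k) * (g x * conj (psi m k x)) := by
    intro x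
    have hx : conj (g x) = conj (partialSum m g (M m s) x) := by
      rw [partialSum_M_eq_self hg hs x]
    rw [hx, partialSum, map_sum, Finset.mul_sum]
    exact Finset.sum_congr rfl fun k _ ↦ by rw [map_mul]; ring
  simp_rw [this]
  rw [integral_finsetSum _ fun k _ ↦ (integrable_mul_conj_psi hg k).const_mul _]
  push_cast
  refine Finset.sum_congr rfl fun k _ ↦ ?_
  rw [integral_const_mul, ← fourierCoeff, Complex.conj_mul']

/-- As s ≤ k, Parseval applies at both ranks `s` and `k` with the same integral, so the nonnegative
terms with index in [M_s, M_k) vanish; k is among them because k < M_k. -/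
theorem fourierCoeff_eq_zero {g : G m → ℂ} (hg : Integrable g (haar m)) {s : ℕ}
    (hs : DependsOn g (Finset.range s)) {k : ℕ} (hk : M m s ≤ k) : fourierCoeff m g k = 0 := by
  have hsk : s ≤ k := (lt_M hm.out s).le.trans hk
  have hk' : DependsOn g (Finset.range k) := fun x y h ↦ hs fun i hi ↦ h i (by
    simp at hi ⊢; omega)
  have h := (sum_norm_fourierCoeff_sq hg hs).trans (sum_norm_fourierCoeff_sq hg hk').symm
  have hle : M m s ≤ M m k := Nat.le_of_dvd (M_pos hm.out k) (M_dvd_M hsk)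
  rw [Complex.ofReal_inj, ← Finset.sum_range_add_sum_Ico _ hle, left_eq_add,
    Finset.sum_eq_zero_iff_of_nonneg fun _ _ ↦ by positivity] at h
  simpa using h k (Finset.mem_Ico.2 ⟨hk, lt_M hm.out k⟩)

theorem partialSum_eq_self {g : G m → ℂ} (hg : Integrable g (haar m)) {s : ℕ}
    (hs : DependsOn g (Finset.range s)) {n : ℕ} (hn : M m s ≤ n) (x : G m) :
    partialSum m g n x = g x := by
  rw [← partialSum_M_eq_self hg hs x, partialSum, ← Finset.sum_range_add_sum_Ico _ hn,
    ← partialSum, add_eq_left]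
  exact Finset.sum_eq_zero fun k hk ↦ by
    rw [fourierCoeff_eq_zero hg hs (Finset.mem_Ico.1 hk).1, zero_mul]

theorem tendsto_fejerMean_of_dependsOn {g : G m → ℂ} (hg : Integrable g (haar m)) {s : ℕ}
    (hs : DependsOn g (Finset.range s)) (x : G m) :
    Tendsto (fun n ↦ fejerMean m g n x) atTop (𝓝 (g x)) := by
  have h : Tendsto (fun n ↦ partialSum m g n x) atTop (𝓝 (g x)) :=
    tendsto_const_nhds.congr' <| (eventually_ge_atTop (M m s)).mono fun n hn ↦
      (partialSum_eq_self hg hs hn x).symm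
  refine h.cesaro_smul.congr fun n ↦ ?_
  simp [fejerMean]

end FinitelyManyCoordinates

end Vilenkin

namespace Vilenkin

open scoped ENNReal

/-! ### From the weak type inequality to almost everywhere convergence -/

section Convergence

variable {m : ℕ → ℕ}

/-- The Fejér means of `f` converge to `f` almost everywhere. -/
def FejerConverges (m : ℕ → ℕ) (f : G m → ℂ) : Prop :=
  ∀ᵐ x ∂haar m, Tendsto (fun n : ℕ ↦ fejerMean m f n x) atTop (𝓝 (f x))

theorem FejerConverges.congr_ae {f g : G m → ℂ} (h : f =ᵐ[haar m] g) (hf : FejerConverges m f) :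
    FejerConverges m g := by
  filter_upwards [hf, h] with x hx hfg
  simpa only [fejerMean_congr_ae h, hfg] using hx

theorem FejerConverges.add {f g : G m → ℂ} (hfi : Integrable f (haar m))
    (hgi : Integrable g (haar m)) (hf : FejerConverges m f) (hg : FejerConverges m g) :
    FejerConverges m (f + g) := by
  filter_upwards [hf, hg] with x hfx hgx
  simpa only [fejerMean_add hfi hgi, Pi.add_apply] using hfx.add hgx

theorem FejerConverges.neg {f : G m → ℂ} (hf : FejerConverges m f) : FejerConverges m (-f) := by
  filter_upwards [hf] with x hfx
  simpa only [fejerMean_neg, Pi.neg_apply] using hfx.neg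

variable [hm : Fact (∀ k, 2 ≤ m k)]

theorem fejerConverges_of_dependsOn {g : G m → ℂ} (hg : Integrable g (haar m)) {s : ℕ}
    (hs : DependsOn g (Finset.range s)) : FejerConverges m g :=
  .of_forall fun x ↦ tendsto_fejerMean_of_dependsOn hg hs x

/-- A weak type bound for the oscillation of the Fejér means near a function for which they
converge. -/
theorem mul_measure_not_eventually_le {B : ℕ} (hB : ∀ k, m k ≤ B) {f g : G m → ℂ}
    (hf : Integrable f (haar m)) (hgi : Integrable g (haar m)) (hg : FejerConverges m g)
    {l : ℝ≥0∞} (hl : l ≠ 0) :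
    l * haar m {x | ¬ ∀ᶠ n in atTop, edist (fejerMean m f n x) (f x) ≤ (12 * B ^ 3 + 2) * l}
      ≤ 4 * ∫⁻ x, ‖f x - g x‖ₑ ∂haar m := by
  have hfg : Integrable (f - g) (haar m) := hf.sub hgi
  set h := hfg.1.mk (f - g)
  have hae : f - g =ᵐ[haar m] h := hfg.1.ae_eq_mk
  have hhm : Measurable h := hfg.1.stronglyMeasurable_mk.measurable
  have hhi : Integrable h (haar m) := hfg.congr hae
  have hsub : ({x | ¬ ∀ᶠ n in atTop, edist (fejerMean m f n x) (f x) ≤ (12 * B ^ 3 + 2) * l} :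
      Set (G m)) ≤ᵐ[haar m]
      ({x | ∃ s, 3 * l < majorant m (fun y ↦ ‖h y‖ₑ) s x} ∪ {x | l ≤ ‖h x‖ₑ} : Set (G m)) := by
    filter_upwards [hg, hae] with x hgx hx hbad
    by_contra hgood
    obtain ⟨h1, h2⟩ := not_or.1 hgood
    have h1' : ∀ s, majorant m (fun y ↦ ‖h y‖ₑ) s x ≤ 3 * l := by simpa using h1
    have h2' : ‖h x‖ₑ < l := not_le.1 h2
    refine hbad ?_
    filter_upwards [EMetric.tendsto_nhds.1 hgx l hl.bot_lt] with n hn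
    -- With f = (f - g) + g the three pieces contribute 4B³ · 3l, l and l, whence the constant 12B³
    -- + 2.
    have e1 : fejerMean m f n x - f x
        = fejerMean m h n x + (fejerMean m g n x - g x) - h x := by
      have e2 : f = (f - g) + g := by simp
      rw [← hx, ← fejerMean_congr_ae hae]
      conv_lhs => rw [e2, fejerMean_add hfg hgi]
      simp only [Pi.add_apply, Pi.sub_apply]
      ring
    rw [edist_eq_enorm_sub, e1]
    calc _ ≤ ‖fejerMean m h n x‖ₑ + ‖fejerMean m g n x - g x‖ₑ + ‖h x‖ₑ :=
          enorm_sub_le.trans (by gcongr; exact enorm_add_le _ _)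
      _ ≤ 4 * B ^ 3 * (3 * l) + l + l := by
          gcongr
          · exact enorm_fejerMean_le hB hhi hhm h1' n
          · rw [← edist_eq_enorm_sub]; exact hn.le
      _ = _ := by ring
  have hint : ∫⁻ x, ‖f x - g x‖ₑ ∂haar m = ∫⁻ x, ‖h x‖ₑ ∂haar m :=
    lintegral_congr_ae (hae.mono fun x hx ↦ by simp only [← hx, Pi.sub_apply])
  calc _ ≤ l * haar m {x | ∃ s, 3 * l < majorant m (fun y ↦ ‖h y‖ₑ) s x}
          + l * haar m {x | l ≤ ‖h x‖ₑ} := by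
        rw [← mul_add]
        exact mul_le_mul_right ((measure_mono_ae hsub).trans (measure_union_le _ _)) _
    _ ≤ 3 * (∫⁻ x, ‖h x‖ₑ ∂haar m) + ∫⁻ x, ‖h x‖ₑ ∂haar m :=
        add_le_add (mul_measure_lt_majorant_le hhm.enorm l)
          (mul_meas_ge_le_lintegral hhm.enorm l)
    _ = _ := by rw [hint]; ring

/-- For fixed `l` the bad set does not depend on `g`, so letting `g` approach `f` in L1 makes it
null; then `l` runs through a null sequence. -/
theorem fejerConverges_of_approx (hbdd : BddAbove (Set.range m)) {f : G m → ℂ}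
    (hf : Integrable f (haar m))
    (h : ∀ ε : ℝ≥0∞, ε ≠ 0 → ∃ g : G m → ℂ, Integrable g (haar m) ∧ FejerConverges m g
      ∧ ∫⁻ x, ‖f x - g x‖ₑ ∂haar m ≤ ε) : FejerConverges m f := by
  obtain ⟨B, hB⟩ := hbdd
  have hB : ∀ k, m k ≤ B := fun k ↦ hB ⟨k, rfl⟩
  set C : ℝ≥0∞ := 12 * B ^ 3 + 2
  have hC : C ≠ ∞ := by simp [C, ENNReal.mul_eq_top]
  have key : ∀ l : ℝ≥0∞, l ≠ 0 →
      ∀ᵐ x ∂haar m, ∀ᶠ n in atTop, edist (fejerMean m f n x) (f x) ≤ C * l := by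
    intro l hl
    rw [ae_iff]
    by_contra hpos
    have hne := mul_ne_zero hl hpos
    set a := l * haar m {x | ¬ ∀ᶠ n in atTop, edist (fejerMean m f n x) (f x) ≤ C * l}
    have ha : ∀ ε : ℝ≥0∞, ε ≠ 0 → a ≤ 4 * ε := fun ε hε ↦ by
      obtain ⟨g, hgi, hg, hfg⟩ := h ε hε
      exact (mul_measure_not_eventually_le hB hf hgi hg hl).trans (mul_le_mul_right hfg _)
    -- ε = 1 shows that `a` is finite; then ε = a/8 gives a ≤ a/2, a contradiction for a ≠ 0.
    have h1 := ha 1 one_ne_zero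
    have hfin : a ≠ ∞ := (h1.trans_lt (by norm_num)).ne
    have h2 := ha (a / 8) (by simp [hne])
    refine h2.not_gt ?_
    have : 4 * (a / 8) = a / 2 := by
      rw [← mul_div_assoc, show (8 : ℝ≥0∞) = 4 * 2 by norm_num,
        ENNReal.mul_div_mul_left _ _ (by simp) (by simp)]
    rw [this]
    exact ENNReal.half_lt_self hne hfin
  have key' : ∀ᵐ x ∂haar m, ∀ j : ℕ, ∀ᶠ n in atTop,
      edist (fejerMean m f n x) (f x) ≤ C * (j : ℝ≥0∞)⁻¹ :=
    ae_all_iff.2 fun j ↦ key _ (by simp)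
  filter_upwards [key'] with x hx
  refine EMetric.tendsto_nhds.2 fun ε hε ↦ ?_
  have hlim : Tendsto (fun j : ℕ ↦ C * (j : ℝ≥0∞)⁻¹) atTop (𝓝 (C * 0)) :=
    ENNReal.Tendsto.const_mul ENNReal.tendsto_inv_nat_nhds_zero (.inr hC)
  rw [mul_zero] at hlim
  obtain ⟨j, hj⟩ := (hlim.eventually (gt_mem_nhds hε)).exists
  exact (hx j).mono fun n hn ↦ hn.trans_lt hj

theorem integrable_indicator_const (c : ℂ) {s : Set (G m)} (hs : MeasurableSet s) :
    Integrable (s.indicator fun _ ↦ c) (haar m) :=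
  (integrable_const c).indicator hs

theorem fejerConverges_indicator_pi (c : ℂ) (I : Finset ℕ) (t : ∀ i, Set (ZMod (m i))) :
    FejerConverges m ((Set.pi I t).indicator fun _ ↦ c) := by
  refine fejerConverges_of_dependsOn (s := I.sup id + 1) (integrable_indicator_const c
    (.pi I.countable_toSet fun i _ ↦ trivial)) fun x y h ↦ ?_
  have hxy : x ∈ Set.pi (I : Set ℕ) t ↔ y ∈ Set.pi (I : Set ℕ) t :=
    forall₂_congr fun i hi ↦ by
      rw [h i (by simpa [Nat.lt_succ_iff] using Finset.le_sup (f := id) hi)]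
  by_cases hx : x ∈ Set.pi (I : Set ℕ) t
  · rw [Set.indicator_of_mem hx, Set.indicator_of_mem (hxy.1 hx)]
  · rw [Set.indicator_of_notMem hx, Set.indicator_of_notMem (mt hxy.2 hx)]

theorem fejerConverges_indicator_compl {c : ℂ} {s : Set (G m)} (hs : MeasurableSet s)
    (h : FejerConverges m (s.indicator fun _ ↦ c)) :
    FejerConverges m (sᶜ.indicator fun _ ↦ c) := by
  rw [Set.indicator_compl, sub_eq_add_neg]
  exact (fejerConverges_of_dependsOn (s := 0) (integrable_const c) fun _ _ _ ↦ rfl).add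
    (integrable_const c) (integrable_indicator_const c hs).neg h.neg

theorem fejerConverges_indicator_biUnion {c : ℂ} {s : ℕ → Set (G m)}
    (hd : Pairwise (Function.onFun Disjoint s)) (hs : ∀ i, MeasurableSet (s i))
    (h : ∀ i, FejerConverges m ((s i).indicator fun _ ↦ c)) (n : ℕ) :
    FejerConverges m ((⋃ i ∈ Finset.range n, s i).indicator fun _ ↦ c) := by
  induction n with
  | zero =>
    simpa using fejerConverges_of_dependsOn (m := m) (s := 0) (g := fun _ ↦ 0)
      (integrable_zero _ _ _) fun _ _ _ ↦ rfl
  | succ n ih =>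
    rw [Finset.range_add_one, Finset.set_biUnion_insert, Set.indicator_union_of_disjoint]
    · exact (h n).add (integrable_indicator_const c (hs n))
        (integrable_indicator_const c (Finset.measurableSet_biUnion _ fun i _ ↦ hs i)) ih
    · simp only [Set.disjoint_iUnion_right]
      exact fun i hi ↦ hd (Finset.mem_range.1 hi).ne'

/-- The finite unions approximate the full union in L1 by continuity of the measure. Within the
induction over sets, only this step needs the maximal inequality. -/
theorem fejerConverges_indicator_iUnion (hbdd : BddAbove (Set.range m)) {c : ℂ}
    {s : ℕ → Set (G m)} (hd : Pairwise (Function.onFun Disjoint s)) (hs : ∀ i, MeasurableSet (s i))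
    (h : ∀ i, FejerConverges m ((s i).indicator fun _ ↦ c)) :
    FejerConverges m ((⋃ i, s i).indicator fun _ ↦ c) := by
  refine fejerConverges_of_approx hbdd (integrable_indicator_const c (.iUnion hs)) fun ε hε ↦ ?_
  have hfin : ∀ n, MeasurableSet (⋃ i ∈ Finset.range n, s i) :=
    fun n ↦ Finset.measurableSet_biUnion _ fun i _ ↦ hs i
  have hlim : Tendsto (fun n ↦ ‖c‖ₑ * haar m ((⋃ i, s i) \ ⋃ i ∈ Finset.range n, s i)) atTop
      (𝓝 (‖c‖ₑ * 0)) := by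
    refine ENNReal.Tendsto.const_mul ?_ (.inr enorm_ne_top)
    have hempty : ⋂ n, ((⋃ i, s i) \ ⋃ i ∈ Finset.range n, s i) = ∅ := by
      ext x
      simp only [Set.mem_iInter, Set.mem_sdiff, Set.mem_iUnion, Finset.mem_range,
        Set.mem_empty_iff_false, iff_false, not_forall]
      by_cases hx : ∃ i, x ∈ s i
      · obtain ⟨i, hi⟩ := hx
        exact ⟨i + 1, fun hh ↦ hh.2 ⟨i, i.lt_succ_self, hi⟩⟩
      · exact ⟨0, fun hh ↦ hx hh.1⟩
    have := tendsto_measure_iInter_atTop (μ := haar m)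
      (s := fun n ↦ (⋃ i, s i) \ ⋃ i ∈ Finset.range n, s i)
      (fun n ↦ ((MeasurableSet.iUnion hs).diff (hfin n)).nullMeasurableSet)
      (fun a b hab ↦ Set.sdiff_subset_sdiff_right
        (Set.biUnion_subset_biUnion_left (Finset.range_mono hab)))
      ⟨0, measure_ne_top _ _⟩
    rwa [hempty, measure_empty] at this
  rw [mul_zero] at hlim
  obtain ⟨n, hn⟩ := (hlim.eventually (gt_mem_nhds hε.bot_lt)).exists
  refine ⟨_, integrable_indicator_const c (hfin n), fejerConverges_indicator_biUnion hd hs h n, ?_⟩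
  refine le_trans (le_of_eq ?_) hn.le
  rw [← lintegral_indicator_const ((MeasurableSet.iUnion hs).diff (hfin n))]
  refine lintegral_congr fun x ↦ ?_
  have hsub : (⋃ i ∈ Finset.range n, s i) ⊆ ⋃ i, s i :=
    Set.iUnion₂_subset fun i _ ↦ Set.subset_iUnion s i
  rw [← Pi.sub_apply, ← Set.indicator_sdiff hsub, enorm_indicator_eq_indicator_enorm]

/-- Dynkin's π-λ argument, starting from the cylinders, whose indicators depend on finitely many
coordinates. -/
theorem fejerConverges_indicator (hbdd : BddAbove (Set.range m)) (c : ℂ) {s : Set (G m)}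
    (hs : MeasurableSet s) : FejerConverges m (s.indicator fun _ ↦ c) := by
  refine MeasurableSpace.induction_on_inter
    (C := fun s _ ↦ FejerConverges m (s.indicator fun _ ↦ c)) generateFrom_squareCylinders.symm
    (isPiSystem_squareCylinders (fun _ ↦ MeasurableSpace.isPiSystem_measurableSet) (by simp))
    ?_ ?_ (fun t ht h ↦ fejerConverges_indicator_compl ht h)
    (fun f hd hf h ↦ fejerConverges_indicator_iUnion hbdd hd hf h) s hs
  · simpa using fejerConverges_indicator_pi (m := m) c {0} fun _ ↦ ∅
  · rintro - ⟨I, t, -, rfl⟩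
    exact fejerConverges_indicator_pi c I t

theorem fejerConverges_of_integrable (hbdd : BddAbove (Set.range m)) {f : G m → ℂ}
    (hf : Integrable f (haar m)) : FejerConverges m f := by
  refine Integrable.induction (FejerConverges m)
    (fun c s hs _ ↦ fejerConverges_indicator hbdd c hs)
    (fun f g _ hf hg h h' ↦ h.add hf hg h') ?_ (fun f g h _ hf ↦ hf.congr_ae h) hf
  -- Closedness of the good class in L1 is again the approximation criterion.
  refine isClosed_of_closure_subset fun F hF ↦ ?_
  refine fejerConverges_of_approx hbdd (L1.integrable_coeFn F) fun ε hε ↦ ?_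
  obtain ⟨g, hg, hFg⟩ := EMetric.mem_closure_iff.1 hF ε hε.bot_lt
  refine ⟨g, L1.integrable_coeFn g, hg, ?_⟩
  rw [Lp.edist_def, eLpNorm_one_eq_lintegral_enorm] at hFg
  exact hFg.le

end Convergence

end Vilenkin

theorem mainTheorem6 (m : ℕ → ℕ) (hm : ∀ k, 2 ≤ m k) (hbdd : BddAbove (Set.range m))
    (f : Vilenkin.G m → ℂ) (hf : Integrable f (Vilenkin.haar m)) :
    ∀ᵐ x ∂(Vilenkin.haar m),
      Tendsto (fun n : ℕ => Vilenkin.fejerMean m f n x) atTop (𝓝 (f x)) :=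
  haveI : Fact (∀ k, 2 ≤ m k) := ⟨hm⟩
  Vilenkin.fejerConverges_of_integrable hbdd hf
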